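/- Let $T,\alpha,\beta>0$. Let $\|\cdot\|_M$ be the Radon norm on $(0,T)$ (dual to the uniform norm $\|\cdot\|_C$ on $C_0(0,T)$), let $\mathrm{BV}(0,T)$ be the space of all $u\in L^1(0,T)$ with $\|Du\|_M<\infty$, with norm $\|u\|_{\mathrm{BV}}=\|u\|_{L^1}+\|Du\|_M$, and put $$\operatorname{TGV}(u)=\inf_{w\in \mathrm{BV}(0,T)}\ \alpha\|Du-w\|_M+\beta\|Dw\|_M .$$ Let $\mathcal L$ be the space of affine functions $x\mapsto cx+d$, $S_y=1_{(y,T)}$, and $K_y(x)=(y-x)1_{(0,y)}(x)$ if $y<T/2$, $K_y(x)=(x-y)1_{(y,T)}(x)$ if $y\ge T/2$. Set $$\operatorname{Ext}B=\{\pm S_y/\alpha : y\in(0,T)\}\cup\{\pm K_y/\beta : y\in(\beta/\alpha,\,T-\beta/\alpha)\}.$$ Let $f:L^2(0,T)\to\mathbb R$ be continuously Fréchet differentiable with Lipschitz continuous gradient $\nabla f:L^2(0,T)\to L^2(0,T)$, let $f(u)\ge -C_f$ for all $u$ with some $C_f>0$, and assume that every sublevel set $\{u\in \mathrm{BV}(0,T):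 J(u)\le c\}$, $c\in\mathbb R$, of $J=f+\operatorname{TGV}$ is bounded in $\mathrm{BV}(0,T)$. For a finite set $\mathcal A\subset \operatorname{Ext}B$ let $\mathcal P(\mathcal A)$ be the problem of minimizing $f\big(\sum_{a\in\mathcal A}\lambda_a a+\ell\big)+\sum_{a\in\mathcal A}\lambda_a$ over all $\lambda\in[0,\infty)^{\mathcal A}$ and $\ell\in\mathcal L$. Consider the following algorithm. Start with a finite set $\mathcal A_0\subset\operatorname{Ext}B$ and put $\mathcal A_0^+=\mathcal A_0$. For $k\ge 0$, given $\mathcal A_k^+$, choose a minimizer $(\lambda^{k+1},\ell^{k+1})$ of $\mathcal P(\mathcal A_k^+)$ and set $$u_{k+1}=\sum_{a\in\mathcal A_k^+}\lambda^{k+1}_a a+\ell^{k+1},\qquad \mathcal A_{k+1}=\{a\in\mathcal A_k^+ : \lambda^{k+1}_a\ne 0\}.$$ For $k\ge 1$, put $p_k(x)=\int_0^x\nabla f(u_k)(s)\,ds$ and $P_k(x)=-\int_0^x p_k(s)\,ds$. If $\|p_k\|_C\le\alpha$ and $\|P_k\|_C\le\beta$, the algorithm terminates. Otherwise choose $\hat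 x^S_k,\hat x^K_k\in(0,T)$ with $|p_k(\hat x^S_k)|=\|p_k\|_C$ and $|P_k(\hat x^K_k)|=\|P_k\|_C$, and set $\mathcal A_k^+=\mathcal A_k\cup\{\widehat u_k\}$, where $$\widehat u_k=\begin{cases}\dfrac{\operatorname{sign}(p_k(\hat x^S_k))}{\alpha}\,S_{\hat x^S_k} & \text{if } \|p_k\|_C/\alpha\ge\|P_k\|_C/\beta,\\[2mm] \dfrac{\operatorname{sign}(P_k(\hat x^K_k))}{\beta}\,K_{\hat x^K_k} & \text{otherwise.}\end{cases}$$ Suppose that the algorithm does not terminate, and let $(u_k)_{k\ge1}$ be any sequence generated by it. With $M_0=f(0)+C_f$ define $$\Psi(u_k)=M_0\left(\max\{\|p_k\|_C/\alpha,\ \|P_k\|_C/\beta\}-1\right).$$ Then $u_k\in \mathrm{BV}(0,T)$ and $\operatorname{TGV}(u_k)<\infty$ for all $k\ge1$, and $$\lim_{k\to\infty}\left(\Psi(u_k)+\Big|\sum_{a\in\mathcal A_k}\lambda^k_a-\operatorname{TGV}(u_k)\Big|\right)=0 .$$ -/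

import Mathlib

open MeasureTheory Set Filter Topology
open scoped ENNReal NNReal ContDiff

noncomputable section

namespace TGV1D

/-- The Hilbert space `L²(0,T)`. -/
abbrev L2 (T : ℝ) : Type := Lp ℝ 2 (volume.restrict (Ioo (0 : ℝ) T))

/-- Test functions: `v ∈ C_c^∞(0,T)` with `|v| ≤ 1`. -/
def IsUnitTest (T : ℝ) (v : ℝ → ℝ) : Prop :=
  ContDiff ℝ ∞ v ∧ HasCompactSupport v ∧ tsupport v ⊆ Ioo 0 T ∧ ∀ x, |v x| ≤ 1

/-- `‖Du - w‖_M`: the Radon norm on `(0,T)` of the distribution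
`v ↦ ⟨Du - w, v⟩ = -∫ u v' - ∫ w v` (equal to `∞` if this is not a finite measure). -/
def radonNormSub (T : ℝ) (u w : ℝ → ℝ) : ℝ≥0∞ :=
  ⨆ (v : ℝ → ℝ) (_ : IsUnitTest T v),
    ENNReal.ofReal (-(∫ x in Ioo 0 T, u x * deriv v x) - ∫ x in Ioo 0 T, w x * v x)

/-- `TV(u) = ‖Du‖_M`. -/
def TV (T : ℝ) (u : ℝ → ℝ) : ℝ≥0∞ := radonNormSub T u (fun _ => 0)

/-- `u ∈ BV(0,T)`: an integrable function whose distributional derivative is a finite measure. -/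
def MemBV (T : ℝ) (u : ℝ → ℝ) : Prop := IntegrableOn u (Ioo 0 T) ∧ TV T u < ⊤

/-- `‖u‖_BV = ‖u‖_{L¹} + TV(u)`. -/
def bvNorm (T : ℝ) (u : ℝ → ℝ) : ℝ≥0∞ := (∫⁻ x in Ioo 0 T, ‖u x‖ₑ) + TV T u

/-- The total generalized variation of order two,
`TGV(u) = inf { α ‖Du - w‖_M + β ‖Dw‖_M | w ∈ BV(0,T) }`. -/
def TGV (T α β : ℝ) (u : ℝ → ℝ) : ℝ≥0∞ :=
  ⨅ (w : ℝ → ℝ) (_ : MemBV T w),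
    ENNReal.ofReal α * radonNormSub T u w + ENNReal.ofReal β * TV T w

/-- The objective `J(u) = f(u) + TGV(u)`. -/
def J (T α β : ℝ) (f : L2 T → ℝ) (u : L2 T) : EReal := (f u : EReal) + (TGV T α β u : EReal)

/-- Every sublevel set `{u ∈ BV(0,T) | J(u) ≤ c}` is bounded in `BV(0,T)`. (Elements of `BV(0,T)`
are bounded, so that all of them belong to `L²(0,T)`.) -/
def SublevelsBounded (T α β : ℝ) (f : L2 T → ℝ) : Prop :=
  ∀ c : ℝ, ∃ R : ℝ≥0, ∀ u : L2 T, MemBV T u → J T α β f u ≤ (c : EReal) → bvNorm T u ≤ R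

/-- The jump function `S_y = 1_{(y,T)}`. -/
def jumpFun (T y : ℝ) : ℝ → ℝ := (Ioo y T).indicator (fun _ => 1)

/-- The kink function `K_y`: `(y - x) 1_{(0,y)}(x)` if `y < T/2`, and `(x - y) 1_{(y,T)}(x)`
otherwise. -/
def kinkFun (T y : ℝ) : ℝ → ℝ :=
  if y < T / 2 then (Ioo 0 y).indicator (fun x => y - x) else (Ioo y T).indicator (fun x => x - y)

theorem memLp_jumpFun (T y : ℝ) : MemLp (jumpFun T y) 2 (volume.restrict (Ioo (0 : ℝ) T)) :=
  (memLp_const (1 : ℝ)).indicator measurableSet_Ioo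

theorem memLp_affine (T c d : ℝ) :
    MemLp (fun x : ℝ => c * x + d) 2 (volume.restrict (Ioo (0 : ℝ) T)) := by
  refine MemLp.of_bound (C := |c| * |T| + |d|) (by fun_prop) ?_
  filter_upwards [ae_restrict_mem measurableSet_Ioo] with x hx
  have h1 : |x| ≤ |T| := by
    rw [abs_of_pos hx.1]; exact hx.2.le.trans (le_abs_self T)
  calc ‖c * x + d‖ ≤ |c * x| + |d| := abs_add_le _ _
    _ ≤ |c| * |T| + |d| := by rw [abs_mul]; gcongr

theorem memLp_kinkFun (T y : ℝ) : MemLp (kinkFun T y) 2 (volume.restrict (Ioo (0 : ℝ) T)) := by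
  unfold kinkFun
  split_ifs
  · have h := (memLp_affine T (-1) y).indicator (s := Ioo 0 y) measurableSet_Ioo
    have e : (fun x : ℝ => y - x) = fun x => -1 * x + y := by funext x; ring
    rwa [e]
  · have h := (memLp_affine T 1 (-y)).indicator (s := Ioo y T) measurableSet_Ioo
    have e : (fun x : ℝ => x - y) = fun x => 1 * x + -y := by funext x; ring
    rwa [e]

/-- `S_y` as an element of `L²(0,T)`. -/
def jump (T y : ℝ) : L2 T := (memLp_jumpFun T y).toLp (jumpFun T y)

/-- `K_y` as an element of `L²(0,T)`. -/
def kink (T y : ℝ) : L2 T := (memLp_kinkFun T y).toLp (kinkFun T y)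

/-- The set `Ext B` of representatives of the extremal points of the TGV unit ball:
`±S_y/α` with `y ∈ (0,T)` and `±K_y/β` with `y ∈ (β/α, T - β/α)`. -/
def extB (T α β : ℝ) : Set (L2 T) :=
  {a | ∃ σ : ℝ, (σ = 1 ∨ σ = -1) ∧
    ((∃ y ∈ Ioo 0 T, a = (σ / α) • jump T y) ∨
      (∃ y ∈ Ioo (β / α) (T - β / α), a = (σ / β) • kink T y))}

/-- The affine functions `x ↦ c x + d` in `L²(0,T)`. -/
def affineL2 (T : ℝ) : Set (L2 T) :=
  {ℓ | ∃ c d : ℝ, ∀ᵐ x ∂(volume.restrict (Ioo (0 : ℝ) T)), ℓ x = c * x + d}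

/-- The conic combination `∑_{a ∈ A} λ_a a + ℓ`. -/
def combo {T : ℝ} (A : Finset (L2 T)) (lam : L2 T → ℝ) (ℓ : L2 T) : L2 T :=
  ∑ a ∈ A, lam a • a + ℓ

/-- `(λ, ℓ)` solves the subproblem `P(A)`: minimize `f(∑_{a ∈ A} λ_a a + ℓ) + ∑_{a ∈ A} λ_a` over
all nonnegative weights `λ` on `A` and all affine `ℓ`. -/
def IsSubproblemMin {T : ℝ} (f : L2 T → ℝ) (A : Finset (L2 T)) (lam : L2 T → ℝ) (ℓ : L2 T) :
    Prop :=
  (∀ a ∈ A, 0 ≤ lam a) ∧ ℓ ∈ affineL2 T ∧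
    ∀ (lam' : L2 T → ℝ) (ℓ' : L2 T), (∀ a ∈ A, 0 ≤ lam' a) → ℓ' ∈ affineL2 T →
      f (combo A lam ℓ) + ∑ a ∈ A, lam a ≤ f (combo A lam' ℓ') + ∑ a ∈ A, lam' a

/-- The first dual variable `p(x) = ∫_0^x ∇f(u)(s) ds`. -/
def dualp {T : ℝ} (f : L2 T → ℝ) (u : L2 T) (x : ℝ) : ℝ := ∫ s in (0 : ℝ)..x, (gradient f u) s

/-- The second dual variable `P(x) = -∫_0^x p(s) ds`. -/
def dualP {T : ℝ} (f : L2 T → ℝ) (u : L2 T) (x : ℝ) : ℝ := -∫ s in (0 : ℝ)..x, dualp f u s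

/-- The uniform norm on `(0,T)`. -/
def supNorm (T : ℝ) (g : ℝ → ℝ) : ℝ := ⨆ x : Ioo (0 : ℝ) T, |g x|

/-- `uhat` is a new candidate point at the iterate `u`: for some points `xS, xK ∈ (0,T)` at which
`|p|` and `|P|` are maximal, `uhat = (sign p(xS) / α) S_{xS}` if `‖p‖/α ≥ ‖P‖/β`, and
`uhat = (sign P(xK) / β) K_{xK}` otherwise. -/
def IsCandidate (T α β : ℝ) (f : L2 T → ℝ) (u uhat : L2 T) : Prop :=
  ∃ xS ∈ Ioo 0 T, ∃ xK ∈ Ioo 0 T,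
    |dualp f u xS| = supNorm T (dualp f u) ∧ |dualP f u xK| = supNorm T (dualP f u) ∧
    uhat = if supNorm T (dualP f u) / β ≤ supNorm T (dualp f u) / α
      then (Real.sign (dualp f u xS) / α) • jump T xS
      else (Real.sign (dualP f u xK) / β) • kink T xK

open Classical in
/-- A non-terminating run of the greedy algorithm. For `k ≥ 1`, `A k` is the active set, `Aplus k`
the enlarged active set, `u k` the iterate, `uhat k` the new candidate, and `lam k`, `ell k` are the
weights and the affine part that constitute `u k`. The set `A 0 = Aplus 0` is the input;
`u 0`, `uhat 0`, `lam 0`, `ell 0` are not used. -/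
structure IsRun (T α β : ℝ) (f : L2 T → ℝ) (A Aplus : ℕ → Finset (L2 T)) (lam : ℕ → L2 T → ℝ)
    (ell u uhat : ℕ → L2 T) : Prop where
  init : ∀ a ∈ A 0, a ∈ extB T α β
  plus_zero : Aplus 0 = A 0
  minimize : ∀ k, IsSubproblemMin f (Aplus k) (lam (k + 1)) (ell (k + 1))
  iterate : ∀ k, u (k + 1) = combo (Aplus k) (lam (k + 1)) (ell (k + 1))
  prune : ∀ k, A (k + 1) = (Aplus k).filter (fun a => lam (k + 1) a ≠ 0)
  not_terminated : ∀ k, 1 ≤ k →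
    ¬ (supNorm T (dualp f (u k)) ≤ α ∧ supNorm T (dualP f (u k)) ≤ β)
  candidate : ∀ k, 1 ≤ k → IsCandidate T α β f (u k) (uhat k)
  plus : ∀ k, 1 ≤ k → Aplus k = insert (uhat k) (A k)

/-- The constraint violation `Ψ(u) = M₀ (max {‖p‖/α, ‖P‖/β} - 1)` with `M₀ = f(0) + C_f`. -/
def Psi (T α β Cf : ℝ) (f : L2 T → ℝ) (u : L2 T) : ℝ :=
  (f 0 + Cf) * (max (supNorm T (dualp f u) / α) (supNorm T (dualP f u) / β) - 1)

end TGV1D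

end

noncomputable section

namespace TGV1D

/-! ### Pairings of the atoms with `L²` functions -/

/-- The primitive of `g` that vanishes at the origin. -/
def prim (g : ℝ → ℝ) (x : ℝ) : ℝ := ∫ s in (0 : ℝ)..x, g s

@[simp] theorem prim_zero (g : ℝ → ℝ) : prim g 0 = 0 := by simp [prim]

theorem integral_mul_sub {g : ℝ → ℝ} {y : ℝ} (hg : IntervalIntegrable g volume 0 y) :
    ∫ x in (0 : ℝ)..y, g x * (y - x) = prim (prim g) y := by
  have hG : AbsolutelyContinuousOnInterval (prim g) 0 y :=
    hg.absolutelyContinuousOnInterval_intervalIntegral (by simp)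
  have hl : AbsolutelyContinuousOnInterval (fun x : ℝ => y - x) 0 y :=
    ContDiffOn.absolutelyContinuousOnInterval (by fun_prop)
  have h := hG.integral_mul_deriv_eq_deriv_mul hl
  have hd : ∫ x in (0 : ℝ)..y, deriv (prim g) x * (y - x) = ∫ x in (0 : ℝ)..y, g x * (y - x) := by
    apply intervalIntegral.integral_congr_ae
    filter_upwards [hg.ae_hasDerivAt_integral] with x hx hxy
    have := (hx (uIoc_subset_uIcc hxy) 0 (by simp)).deriv
    rw [show deriv (prim g) x = g x from this]
  have hd' : ∀ x : ℝ, deriv (fun x : ℝ => y - x) x = -1 := fun x => by simp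
  rw [hd] at h
  simp only [hd', sub_self, mul_zero, prim_zero, zero_mul, zero_sub, mul_neg, mul_one,
    intervalIntegral.integral_neg, neg_inj] at h
  exact h.symm

theorem intervalIntegrable_L2 {T : ℝ} (g : L2 T) {a b : ℝ} (ha : 0 ≤ a) (hab : a ≤ b)
    (hb : b ≤ T) : IntervalIntegrable g volume a b := by
  have h : IntegrableOn g (Ioo 0 T) := (Lp.memLp g).integrable (by norm_num)
  rw [intervalIntegrable_iff_integrableOn_Ioo_of_le hab]
  exact h.mono_set (Ioo_subset_Ioo ha hb)

theorem inner_toLp_left {T : ℝ} {φ : ℝ → ℝ} (hφ : MemLp φ 2 (volume.restrict (Ioo (0 : ℝ) T)))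
    (g : L2 T) : inner ℝ (hφ.toLp φ) g = ∫ x in Ioo 0 T, g x * φ x := by
  rw [L2.inner_def]
  apply integral_congr_ae
  filter_upwards [hφ.coeFn_toLp] with x hx
  rw [hx]
  simp

theorem setIntegral_Ioo_indicator {T a b : ℝ} (ha : 0 ≤ a) (hab : a ≤ b) (hb : b ≤ T)
    (g φ : ℝ → ℝ) :
    ∫ x in Ioo 0 T, g x * (Ioo a b).indicator φ x = ∫ x in a..b, g x * φ x := by
  have : (fun x => g x * (Ioo a b).indicator φ x) = (Ioo a b).indicator (fun x => g x * φ x) := by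
    funext x
    by_cases hx : x ∈ Ioo a b <;> simp [hx]
  rw [this, setIntegral_indicator measurableSet_Ioo,
    inter_eq_self_of_subset_right (Ioo_subset_Ioo ha hb), intervalIntegral.integral_of_le hab,
    integral_Ioc_eq_integral_Ioo]

theorem integral_mul_linear_tail {T y : ℝ} (hy : y ∈ Icc 0 T) (g : L2 T) :
    ∫ x in y..T, g x * (x - y) =
      (T - y) * prim g T - prim (prim g) T + prim (prim g) y := by
  have hT : 0 ≤ T := hy.1.trans hy.2
  have i1 := intervalIntegrable_L2 g le_rfl hy.1 hy.2
  have i2 := intervalIntegrable_L2 g le_rfl hT le_rfl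
  have i3 := intervalIntegrable_L2 g hy.1 hy.2 le_rfl
  have c : Continuous fun x : ℝ => x - y := by fun_prop
  have h1 := integral_mul_sub i1
  have h2 := integral_mul_sub i2
  have h3 := intervalIntegral.integral_add_adjacent_intervals
    (i1.mul_continuousOn c.continuousOn) (i3.mul_continuousOn c.continuousOn)
  have h4 : ∫ x in (0 : ℝ)..T, g x * (x - y) =
      (∫ x in (0 : ℝ)..T, g x * (T - y)) - ∫ x in (0 : ℝ)..T, g x * (T - x) := by
    rw [← intervalIntegral.integral_sub (i2.mul_const _)
      (i2.mul_continuousOn (by fun_prop))]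
    congr 1; funext x; ring
  have h5 : ∫ x in (0 : ℝ)..y, g x * (x - y) = -∫ x in (0 : ℝ)..y, g x * (y - x) := by
    rw [← intervalIntegral.integral_neg]
    congr 1; funext x; ring
  rw [intervalIntegral.integral_mul_const, h2] at h4
  rw [h1] at h5
  have : prim g T = ∫ x in (0 : ℝ)..T, g x := rfl
  rw [this]
  linarith

theorem inner_jump {T y : ℝ} (hy : y ∈ Icc 0 T) (g : L2 T) :
    inner ℝ (jump T y) g = prim g T - prim g y := by
  rw [jump, inner_toLp_left, jumpFun, setIntegral_Ioo_indicator hy.1 hy.2 le_rfl]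
  simp only [mul_one, prim]
  rw [intervalIntegral.integral_interval_sub_left
    (intervalIntegrable_L2 g le_rfl (hy.1.trans hy.2) le_rfl)
    (intervalIntegrable_L2 g le_rfl hy.1 hy.2)]

theorem inner_kink_of_lt {T y : ℝ} (hy : y ∈ Icc 0 T) (h : y < T / 2) (g : L2 T) :
    inner ℝ (kink T y) g = prim (prim g) y := by
  rw [kink, inner_toLp_left, kinkFun, if_pos h, setIntegral_Ioo_indicator le_rfl hy.1 hy.2,
    integral_mul_sub (intervalIntegrable_L2 g le_rfl hy.1 hy.2)]

theorem inner_kink_of_le {T y : ℝ} (hy : y ∈ Icc 0 T) (h : T / 2 ≤ y) (g : L2 T) :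
    inner ℝ (kink T y) g = (T - y) * prim g T - prim (prim g) T + prim (prim g) y := by
  rw [kink, inner_toLp_left, kinkFun, if_neg h.not_gt,
    setIntegral_Ioo_indicator hy.1 hy.2 le_rfl, integral_mul_linear_tail hy]

/-- For `g` orthogonal to the affine functions, both kinds of kinks have the same pairing. -/
theorem inner_kink {T y : ℝ} (hy : y ∈ Icc 0 T) (g : L2 T) (h1 : prim g T = 0)
    (h2 : prim (prim g) T = 0) : inner ℝ (kink T y) g = prim (prim g) y := by
  rcases lt_or_ge y (T / 2) with h | h
  · exact inner_kink_of_lt hy h g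
  · rw [inner_kink_of_le hy h g, h1, h2]; ring

/-- The affine function `x ↦ c x + d` as an element of `L²(0,T)`. -/
def affineElem (T c d : ℝ) : L2 T := (memLp_affine T c d).toLp _

theorem affineElem_mem (T c d : ℝ) : affineElem T c d ∈ affineL2 T :=
  ⟨c, d, (memLp_affine T c d).coeFn_toLp⟩

theorem mem_affineL2_iff {T : ℝ} {ℓ : L2 T} : ℓ ∈ affineL2 T ↔ ∃ c d, ℓ = affineElem T c d := by
  constructor
  · rintro ⟨c, d, h⟩
    refine ⟨c, d, Lp.ext ?_⟩
    filter_upwards [h, (memLp_affine T c d).coeFn_toLp] with x h1 h2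
    rw [h1, affineElem, h2]
  · rintro ⟨c, d, rfl⟩
    exact affineElem_mem T c d

theorem affineElem_add (T c d c' d' : ℝ) :
    affineElem T c d + affineElem T c' d' = affineElem T (c + c') (d + d') := by
  rw [affineElem, affineElem, affineElem, ← MemLp.toLp_add]
  apply MemLp.toLp_congr
  filter_upwards with x
  simp only [Pi.add_apply]; ring

theorem affineElem_smul (T r c d : ℝ) :
    r • affineElem T c d = affineElem T (r * c) (r * d) := by
  rw [affineElem, affineElem, ← MemLp.toLp_const_smul]
  apply MemLp.toLp_congr
  filter_upwards with x
  simp only [Pi.smul_apply, smul_eq_mul]; ring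

theorem inner_affineElem {T : ℝ} (hT : 0 ≤ T) (c d : ℝ) (g : L2 T) :
    inner ℝ (affineElem T c d) g = (c * T + d) * prim g T - c * prim (prim g) T := by
  have i2 := intervalIntegrable_L2 g le_rfl hT le_rfl
  rw [affineElem, inner_toLp_left, ← integral_Ioc_eq_integral_Ioo,
    ← intervalIntegral.integral_of_le hT]
  have : (fun x => g x * (c * x + d)) = fun x => (c * T + d) * g x - c * (g x * (T - x)) := by
    funext x; ring
  rw [this, intervalIntegral.integral_sub (i2.const_mul _)
    ((i2.mul_continuousOn (by fun_prop)).const_mul _), intervalIntegral.integral_const_mul,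
    intervalIntegral.integral_const_mul, integral_mul_sub i2]
  rfl

theorem prim_eq_zero_of_orthogonal {T : ℝ} (hT : 0 ≤ T) {g : L2 T}
    (h : ∀ ℓ ∈ affineL2 T, inner ℝ ℓ g = 0) : prim g T = 0 ∧ prim (prim g) T = 0 := by
  have h0 := h _ (affineElem_mem T 0 1)
  have h1 := h _ (affineElem_mem T 1 (-T))
  rw [inner_affineElem hT] at h0 h1
  constructor <;> linarith

/-! ### Norm bounds for the atoms -/

theorem norm_toLp_le {T C : ℝ} (hC : 0 ≤ C) {φ : ℝ → ℝ}
    (hφ : MemLp φ 2 (volume.restrict (Ioo (0 : ℝ) T))) (hb : ∀ x ∈ Ioo 0 T, |φ x| ≤ C) :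
    ‖hφ.toLp φ‖ ≤
      (measureUnivNNReal (volume.restrict (Ioo (0 : ℝ) T)) : ℝ) ^ (2 : ℝ≥0∞).toReal⁻¹ * C := by
  apply Lp.norm_le_of_ae_bound hC
  filter_upwards [hφ.coeFn_toLp, ae_restrict_mem measurableSet_Ioo] with x hx hxT
  rw [hx]
  exact hb x hxT

theorem exists_norm_atom_le {T : ℝ} (hT : 0 < T) :
    ∃ C > 0, ∀ y ∈ Ioo 0 T, ‖jump T y‖ ≤ C ∧ ‖kink T y‖ ≤ C := by
  set m : ℝ := (measureUnivNNReal (volume.restrict (Ioo (0 : ℝ) T)) : ℝ) ^ (2 : ℝ≥0∞).toReal⁻¹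
    with hm
  have hm0 : 0 ≤ m := by positivity
  refine ⟨m * (1 + T) + 1, by positivity, fun y hy => ⟨?_, ?_⟩⟩
  · refine (norm_toLp_le (C := 1) zero_le_one _ fun x _ => ?_).trans ?_
    · unfold jumpFun indicator
      split_ifs <;> simp
    · rw [← hm]; nlinarith
  · refine (norm_toLp_le (C := T) hT.le _ fun x hx => ?_).trans ?_
    · obtain ⟨hx0, hxT⟩ := hx
      obtain ⟨hy0, hyT⟩ := hy
      simp only [kinkFun]
      split_ifs <;> simp only [indicator] <;> split_ifs <;>
        rw [abs_le] <;> constructor <;> linarith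
    · rw [← hm]; nlinarith

/-! ### Test functions as elements of `L²` -/

theorem memLp_of_continuous {T : ℝ} {φ : ℝ → ℝ} (h : Continuous φ) :
    MemLp φ 2 (volume.restrict (Ioo (0 : ℝ) T)) := by
  obtain ⟨C, hC⟩ := (isCompact_Icc (a := (0 : ℝ)) (b := T)).exists_bound_of_continuousOn
    h.continuousOn
  refine MemLp.of_bound (C := C) h.aestronglyMeasurable ?_
  filter_upwards [ae_restrict_mem measurableSet_Ioo] with x hx
  exact hC x (Ioo_subset_Icc_self hx)

/-- A continuous function as an element of `L²(0,T)`. -/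
def ofCont (T : ℝ) {φ : ℝ → ℝ} (h : Continuous φ) : L2 T := (memLp_of_continuous h).toLp φ

theorem inner_ofCont {T : ℝ} {φ : ℝ → ℝ} (h : Continuous φ) (g : L2 T) :
    inner ℝ (ofCont T h) g = ∫ x in Ioo 0 T, g x * φ x := inner_toLp_left _ _

theorem prim_ofCont {T x : ℝ} (hx : x ∈ Icc 0 T) {φ : ℝ → ℝ} (h : Continuous φ) :
    prim (ofCont T h) x = prim φ x := by
  unfold prim
  rw [intervalIntegral.integral_of_le hx.1, intervalIntegral.integral_of_le hx.1,
    integral_Ioc_eq_integral_Ioo, integral_Ioc_eq_integral_Ioo]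
  apply integral_congr_ae
  exact ae_restrict_of_ae_restrict_of_subset (Ioo_subset_Ioo le_rfl hx.2)
    (memLp_of_continuous h).coeFn_toLp

theorem prim_prim_ofCont {T x : ℝ} (hx : x ∈ Icc 0 T) {φ : ℝ → ℝ} (h : Continuous φ) :
    prim (prim (ofCont T h)) x = prim (prim φ) x := by
  apply intervalIntegral.integral_congr
  intro y hy
  rw [uIcc_of_le hx.1] at hy
  exact prim_ofCont ⟨hy.1, hy.2.trans hx.2⟩ h

theorem prim_deriv {v : ℝ → ℝ} (hv : ContDiff ℝ 1 v) (h0 : v 0 = 0) : prim (deriv v) = v := by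
  funext x
  unfold prim
  rw [intervalIntegral.integral_deriv_eq_sub (fun y _ => hv.differentiable one_ne_zero y)
    (hv.continuous_deriv_one.intervalIntegrable _ _), h0, sub_zero]

namespace IsUnitTest

variable {T : ℝ} {v : ℝ → ℝ}

theorem contDiff_one (hv : IsUnitTest T v) : ContDiff ℝ 1 v := hv.1.of_le (by simp)

theorem cont (hv : IsUnitTest T v) : Continuous v := hv.1.continuous

theorem cont_deriv (hv : IsUnitTest T v) : Continuous (deriv v) :=
  hv.contDiff_one.continuous_deriv_one

theorem eq_zero (hv : IsUnitTest T v) {x : ℝ} (hx : x ∉ Ioo 0 T) : v x = 0 :=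
  image_eq_zero_of_notMem_tsupport fun h => hx (hv.2.2.1 h)

theorem apply_zero (hv : IsUnitTest T v) : v 0 = 0 := hv.eq_zero (by simp)

theorem apply_right (hv : IsUnitTest T v) : v T = 0 := hv.eq_zero (by simp)

theorem prim_ofCont_deriv (hv : IsUnitTest T v) {x : ℝ} (hx : x ∈ Icc 0 T) :
    prim (ofCont T hv.cont_deriv) x = v x := by
  rw [prim_ofCont hx, prim_deriv hv.contDiff_one hv.apply_zero]

theorem prim_prim_ofCont_deriv (hv : IsUnitTest T v) {x : ℝ} (hx : x ∈ Icc 0 T) :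
    prim (prim (ofCont T hv.cont_deriv)) x = prim v x := by
  rw [prim_prim_ofCont hx, prim_deriv hv.contDiff_one hv.apply_zero]

theorem neg (hv : IsUnitTest T v) : IsUnitTest T (-v) := by
  obtain ⟨h1, h2, h3, h4⟩ := hv
  refine ⟨h1.neg, h2.neg, ?_, fun x => by simpa using h4 x⟩
  rwa [tsupport, Function.support_neg, ← tsupport]

end IsUnitTest

/-! ### Upper bounds for `TGV` -/

/-- There is a square integrable `w` with `α ‖Du - w‖ + β ‖Dw‖ ≤ t`. -/
def TGVLe (T α β : ℝ) (u : L2 T) (t : ℝ) : Prop :=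
  ∃ (w : L2 T) (s₁ s₂ : ℝ), 0 ≤ s₁ ∧ 0 ≤ s₂ ∧ α * s₁ + β * s₂ ≤ t ∧
    ∀ v, ∀ hv : IsUnitTest T v,
      -inner ℝ u (ofCont T hv.cont_deriv) - inner ℝ w (ofCont T hv.cont) ≤ s₁ ∧
      -inner ℝ w (ofCont T hv.cont_deriv) ≤ s₂

namespace TGVLe

variable {T α β : ℝ} {u u' : L2 T} {t t' : ℝ}

theorem add (h : TGVLe T α β u t) (h' : TGVLe T α β u' t') : TGVLe T α β (u + u') (t + t') := by
  obtain ⟨w, s₁, s₂, p₁, p₂, hs, H⟩ := h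
  obtain ⟨w', s₁', s₂', p₁', p₂', hs', H'⟩ := h'
  refine ⟨w + w', s₁ + s₁', s₂ + s₂', by positivity, by positivity, by linarith,
    fun v hv => ?_⟩
  simp only [inner_add_left]
  constructor <;> linarith [(H v hv).1, (H v hv).2, (H' v hv).1, (H' v hv).2]

theorem smul {r : ℝ} (hr : 0 ≤ r) (h : TGVLe T α β u t) : TGVLe T α β (r • u) (r * t) := by
  obtain ⟨w, s₁, s₂, p₁, p₂, hs, H⟩ := h
  refine ⟨r • w, r * s₁, r * s₂, by positivity, by positivity, by nlinarith, fun v hv => ?_⟩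
  simp only [real_inner_smul_left]
  constructor <;>
    linarith [mul_le_mul_of_nonneg_left (H v hv).1 hr, mul_le_mul_of_nonneg_left (H v hv).2 hr]

theorem neg (h : TGVLe T α β u t) : TGVLe T α β (-u) t := by
  obtain ⟨w, s₁, s₂, p₁, p₂, hs, H⟩ := h
  refine ⟨-w, s₁, s₂, p₁, p₂, hs, fun v hv => ?_⟩
  have h1 : ofCont T hv.neg.cont = -ofCont T hv.cont :=
    (MemLp.toLp_neg (memLp_of_continuous hv.cont)).symm ▸ rfl
  have h2 : ofCont T hv.neg.cont_deriv = -ofCont T hv.cont_deriv := by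
    rw [ofCont, ofCont, ← MemLp.toLp_neg]
    apply MemLp.toLp_congr
    filter_upwards with x
    simp
  have := H _ hv.neg
  simp only [h1, h2, inner_neg_right, inner_neg_left] at this ⊢
  exact this

theorem sum {ι : Type*} (s : Finset ι) (a : ι → L2 T) (r : ι → ℝ)
    (h : ∀ i ∈ s, TGVLe T α β (a i) (r i)) (h0 : TGVLe T α β u t) :
    TGVLe T α β (∑ i ∈ s, a i + u) (∑ i ∈ s, r i + t) := by
  classical
  induction s using Finset.induction_on with
  | empty => simpa using h0
  | insert i s hi ih =>
    rw [Finset.sum_insert hi, Finset.sum_insert hi, add_assoc, add_assoc]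
    exact (h i (Finset.mem_insert_self i s)).add
      (ih fun j hj => h j (Finset.mem_insert_of_mem hj))

end TGVLe

theorem tgvLe_jump {T y : ℝ} (α β : ℝ) (hy : y ∈ Icc 0 T) : TGVLe T α β (jump T y) α := by
  have hT : T ∈ Icc 0 T := ⟨hy.1.trans hy.2, le_rfl⟩
  refine ⟨0, 1, 0, zero_le_one, le_rfl, by simp, fun v hv => ?_⟩
  rw [inner_jump hy, hv.prim_ofCont_deriv hy, hv.prim_ofCont_deriv hT, hv.apply_right]
  simpa using (abs_le.1 (hv.2.2.2 y)).2

theorem tgvLe_affine {T : ℝ} (α β : ℝ) (hT : 0 ≤ T) {ℓ : L2 T} (h : ℓ ∈ affineL2 T) :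
    TGVLe T α β ℓ 0 := by
  obtain ⟨c, d, rfl⟩ := mem_affineL2_iff.1 h
  have hT' : T ∈ Icc 0 T := ⟨hT, le_rfl⟩
  refine ⟨affineElem T 0 c, 0, 0, le_rfl, le_rfl, by simp, fun v hv => ?_⟩
  simp only [inner_affineElem hT]
  rw [hv.prim_ofCont_deriv hT', hv.prim_prim_ofCont_deriv hT', hv.apply_right,
    prim_ofCont hT']
  constructor <;> simp

theorem tgvLe_kink {T y : ℝ} (α β : ℝ) (hy : y ∈ Icc 0 T) : TGVLe T α β (kink T y) β := by
  have hT : T ∈ Icc 0 T := ⟨hy.1.trans hy.2, le_rfl⟩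
  rcases lt_or_ge y (T / 2) with h | h
  · refine ⟨jump T y + affineElem T 0 (-1), 0, 1, le_rfl, zero_le_one, by simp, fun v hv => ?_⟩
    simp only [inner_add_left, inner_jump hy, inner_affineElem hT.1]
    rw [inner_kink_of_lt hy h, hv.prim_ofCont_deriv hT, hv.prim_prim_ofCont_deriv hT,
      hv.prim_prim_ofCont_deriv hy, hv.apply_right, hv.prim_ofCont_deriv hy, prim_ofCont hT,
      prim_ofCont hy]
    have := (abs_le.1 (hv.2.2.2 y)).2
    constructor <;> linarith
  · refine ⟨jump T y, 0, 1, le_rfl, zero_le_one, by simp, fun v hv => ?_⟩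
    simp only [inner_jump hy]
    rw [inner_kink_of_le hy h, hv.prim_ofCont_deriv hT, hv.prim_prim_ofCont_deriv hT,
      hv.prim_prim_ofCont_deriv hy, hv.apply_right, hv.prim_ofCont_deriv hy, prim_ofCont hT,
      prim_ofCont hy]
    have := (abs_le.1 (hv.2.2.2 y)).2
    constructor <;> linarith

theorem exists_inner_unitTest_le (T : ℝ) (w : L2 T) :
    ∃ R : ℝ, 0 ≤ R ∧ ∀ v, ∀ hv : IsUnitTest T v, inner ℝ w (ofCont T hv.cont) ≤ R := by
  set m : ℝ := (measureUnivNNReal (volume.restrict (Ioo (0 : ℝ) T)) : ℝ) ^ (2 : ℝ≥0∞).toReal⁻¹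
  refine ⟨‖w‖ * (m * 1), by positivity, fun v hv => (real_inner_le_norm _ _).trans ?_⟩
  gcongr
  exact norm_toLp_le zero_le_one _ fun x _ => hv.2.2.2 x

theorem TV_le_of_inner {T s : ℝ} {w : L2 T}
    (h : ∀ v, ∀ hv : IsUnitTest T v, -inner ℝ w (ofCont T hv.cont_deriv) ≤ s) :
    TV T w ≤ ENNReal.ofReal s := by
  refine iSup₂_le fun v hv => ENNReal.ofReal_le_ofReal ?_
  have := h v hv
  rw [real_inner_comm, inner_ofCont] at this
  simpa using this

theorem memBV_of_inner {T s : ℝ} {w : L2 T}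
    (h : ∀ v, ∀ hv : IsUnitTest T v, -inner ℝ w (ofCont T hv.cont_deriv) ≤ s) :
    MemBV T w :=
  ⟨(Lp.memLp w).integrable (by norm_num), (TV_le_of_inner h).trans_lt ENNReal.ofReal_lt_top⟩

theorem TGVLe.memBV {T α β t : ℝ} {u : L2 T} (h : TGVLe T α β u t) : MemBV T u := by
  obtain ⟨w, s₁, s₂, p₁, p₂, hs, H⟩ := h
  obtain ⟨R, hR, hwR⟩ := exists_inner_unitTest_le T w
  exact memBV_of_inner (s := s₁ + R) fun v hv => by linarith [(H v hv).1, hwR v hv]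

theorem TGVLe.TGV_le {T α β t : ℝ} (hα : 0 ≤ α) (hβ : 0 ≤ β) {u : L2 T}
    (h : TGVLe T α β u t) : TGV T α β u ≤ ENNReal.ofReal t := by
  obtain ⟨w, s₁, s₂, p₁, p₂, hs, H⟩ := h
  refine (iInf₂_le (w : ℝ → ℝ) (memBV_of_inner fun v hv => (H v hv).2)).trans ?_
  have h1 : radonNormSub T u w ≤ ENNReal.ofReal s₁ := by
    refine iSup₂_le fun v hv => ENNReal.ofReal_le_ofReal ?_
    have := (H v hv).1
    rwa [real_inner_comm, inner_ofCont, real_inner_comm, inner_ofCont] at this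
  have h2 : TV T w ≤ ENNReal.ofReal s₂ := TV_le_of_inner fun v hv => (H v hv).2
  calc _ ≤ ENNReal.ofReal α * ENNReal.ofReal s₁ + ENNReal.ofReal β * ENNReal.ofReal s₂ := by
        gcongr
    _ = ENNReal.ofReal (α * s₁ + β * s₂) := by
        rw [ENNReal.ofReal_add (by positivity) (by positivity), ENNReal.ofReal_mul hα,
          ENNReal.ofReal_mul hβ]
    _ ≤ _ := ENNReal.ofReal_le_ofReal hs

/-! ### Smooth approximation from inside -/

theorem exists_smooth_approx {T α β : ℝ} (hT : 0 < T) {P : ℝ → ℝ} (hP : ContDiff ℝ 1 P)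
    (h0 : ∀ x, x ∉ Ioo 0 T → P x = 0) (hPβ : ∀ x, |P x| ≤ β) (hPα : ∀ x, |deriv P x| ≤ α) :
    ∃ Φ : ℕ → ℝ → ℝ,
      (∀ n, ContDiff ℝ ∞ (Φ n) ∧ HasCompactSupport (Φ n) ∧ tsupport (Φ n) ⊆ Ioo 0 T ∧
        (∀ x, |Φ n x| ≤ β) ∧ ∀ x, |deriv (Φ n) x| ≤ α) ∧
      ∀ x, Tendsto (fun n => Φ n x) atTop (𝓝 (P x)) ∧
        Tendsto (fun n => deriv (Φ n) x) atTop (𝓝 (deriv P x)) := by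
  set c : ℝ := T / 2 with hc
  have hc0 : 0 < c := by positivity
  set s : ℕ → ℝ := fun n => 1 + 1 / ((n : ℝ) + 1) with hs
  have hs1 : ∀ n, 1 < s n := fun n => by
    have : 0 < 1 / ((n : ℝ) + 1) := by positivity
    simp only [hs]; linarith
  have hs0 : ∀ n, 0 < s n := fun n => one_pos.trans (hs1 n)
  have hslim : Tendsto s atTop (𝓝 1) := by
    simpa [hs] using (tendsto_one_div_add_atTop_nhds_zero_nat (𝕜 := ℝ)).const_add (1 : ℝ)
  have hcs : ∀ n, c / s n < c := fun n => div_lt_self hc0 (hs1 n)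
  set δ : ℕ → ℝ := fun n => (c - c / s n) / 2 with hδ
  have hδ0 : ∀ n, 0 < δ n := fun n => by have := hcs n; simp only [hδ]; linarith
  have hδlim : Tendsto δ atTop (𝓝 0) := by
    have := ((tendsto_const_nhds (x := c)).sub
      ((tendsto_const_nhds (x := c)).div hslim one_ne_zero)).div_const 2
    simpa using this
  let φ : ℕ → ContDiffBump (0 : ℝ) := fun n => ⟨δ n / 2, δ n, half_pos (hδ0 n), half_lt_self (hδ0 n)⟩
  have hφr : ∀ n, (φ n).rOut = δ n := fun n => rfl
  let g : ℕ → ℝ → ℝ := fun n x => (s n)⁻¹ * P (c + (x - c) * s n)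
  let g' : ℕ → ℝ → ℝ := fun n x => deriv P (c + (x - c) * s n)
  have hgC : ∀ n, ContDiff ℝ 1 (g n) := fun n =>
    contDiff_const.mul (hP.comp (by fun_prop))
  have hgd : ∀ n, deriv (g n) = g' n := fun n => by
    funext x
    have h1 : HasDerivAt (fun x : ℝ => c + (x - c) * s n) (s n) x := by
      simpa using (((hasDerivAt_id x).sub_const c).mul_const (s n)).const_add c
    have h2 := ((hP.differentiable one_ne_zero _).hasDerivAt.comp x h1).const_mul (s n)⁻¹
    have h3 := h2.deriv
    rw [show deriv (g n) x = _ from h3]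
    simp only [g']
    field_simp [(hs0 n).ne']
  have hgc : ∀ n, Continuous (g' n) := fun n => hgd n ▸ (hgC n).continuous_deriv_one
  have hgsupp : ∀ n, Function.support (g n) ⊆ Metric.closedBall c (c / s n) := fun n x hx => by
    have : c + (x - c) * s n ∈ Ioo 0 T := by
      by_contra h
      exact hx (by simp [g, h0 _ h])
    have e : |x - c| * s n = |(x - c) * s n| := by rw [abs_mul, abs_of_pos (hs0 n)]
    rw [Metric.mem_closedBall, Real.dist_eq, le_div_iff₀ (hs0 n), e, abs_le]
    constructor <;> linarith [this.1, this.2]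
  have hgcs : ∀ n, HasCompactSupport (g n) := fun n =>
    HasCompactSupport.of_support_subset_isCompact (isCompact_closedBall _ _) (hgsupp n)
  let L := ContinuousLinearMap.lsmul ℝ ℝ (E := ℝ)
  let Φ : ℕ → ℝ → ℝ := fun n => convolution ((φ n).normed volume) (g n) L volume
  have hΦC : ∀ n, ContDiff ℝ ∞ (Φ n) := fun n =>
    (φ n).hasCompactSupport_normed.contDiff_convolution_left _ (φ n).contDiff_normed
      (hgC n).continuous.locallyIntegrable
  have hΦd : ∀ n x, deriv (Φ n) x = convolution ((φ n).normed volume) (g' n) L volume x :=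
    fun n x => by
      have := ((hgcs n).hasDerivAt_convolution_right L
        ((ContDiffBump.continuous_normed (μ := volume) (φ n)).locallyIntegrable (μ := volume)) (hgC n) x).deriv
      rw [hgd] at this
      exact this
  have hΦsupp : ∀ n, Function.support (Φ n) ⊆ Metric.closedBall c (c / s n + δ n) := fun n => by
    refine (support_convolution_subset L).trans ?_
    rintro _ ⟨a, ha, b, hb, rfl⟩
    rw [(φ n).support_normed_eq, hφr, mem_ball_zero_iff] at ha
    have hb := hgsupp n hb
    rw [Metric.mem_closedBall, Real.dist_eq] at hb ⊢
    rw [Real.norm_eq_abs] at ha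
    calc |a + b - c| = |a + (b - c)| := by ring_nf
      _ ≤ |a| + |b - c| := abs_add_le _ _
      _ ≤ _ := by linarith
  have bound : ∀ (n : ℕ) (h : ℝ → ℝ) (C : ℝ), Continuous h → (∀ x, |h x| ≤ C) → ∀ x,
      |convolution ((φ n).normed volume) h L volume x| ≤ C := fun n h C hh hC x => by
    have := dist_convolution_le (μ := volume) (x₀ := x) (z₀ := (0 : ℝ)) (R := (φ n).rOut)
      ((abs_nonneg _).trans (hC 0)) (φ n).support_normed_eq.subset (φ n).nonneg_normed
      (φ n).integral_normed hh.aestronglyMeasurable (fun y _ => by simpa using hC y)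
    simpa using this
  have lim : ∀ (h : ℕ → ℝ → ℝ) (z x : ℝ), (∀ n, Continuous (h n)) →
      Tendsto (Function.uncurry h) (atTop ×ˢ 𝓝 x) (𝓝 z) →
      Tendsto (fun n => convolution ((φ n).normed volume) (h n) L volume x) atTop (𝓝 z) :=
    fun h z x hh hz => ContDiffBump.convolution_tendsto_right (k := fun _ => x) hδlim
      (Eventually.of_forall fun n => (hh n).aestronglyMeasurable) hz tendsto_const_nhds
  have arg : ∀ x, Tendsto (fun p : ℕ × ℝ => c + (p.2 - c) * s p.1) (atTop ×ˢ 𝓝 x) (𝓝 x) :=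
    fun x => by
      have := ((tendsto_snd (f := (atTop : Filter ℕ)) (g := 𝓝 x)).sub_const c).mul
        (hslim.comp (tendsto_fst (g := 𝓝 x))) |>.const_add c
      simpa using this
  refine ⟨Φ, fun n => ⟨hΦC n, ?_, ?_, bound n _ _ (hgC n).continuous fun x => ?_, fun x => ?_⟩,
    fun x => ⟨lim _ _ _ (fun n => (hgC n).continuous) ?_, ?_⟩⟩
  · exact HasCompactSupport.of_support_subset_isCompact (isCompact_closedBall _ _) (hΦsupp n)
  · refine (closure_minimal (hΦsupp n) Metric.isClosed_closedBall).trans fun x hx => ?_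
    rw [Metric.mem_closedBall, Real.dist_eq, abs_le] at hx
    have := hcs n
    simp only [hδ] at hx
    constructor <;> linarith [hx.1, hx.2]
  · simp only [g, abs_mul, abs_inv, abs_of_pos (hs0 n)]
    calc (s n)⁻¹ * |P (c + (x - c) * s n)| ≤ 1 * |P (c + (x - c) * s n)| := by
          gcongr
          exact inv_le_one_of_one_le₀ (hs1 n).le
      _ ≤ β := by rw [one_mul]; exact hPβ _
  · rw [hΦd]
    exact bound n _ _ (hgc n) (fun y => hPα _) x
  · have h1 := (hP.continuous.tendsto x).comp (arg x)
    have h2 := ((hslim.comp (tendsto_fst (g := 𝓝 x))).inv₀ one_ne_zero).mul h1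
    simpa [Function.uncurry_def, g, Function.comp_def] using h2
  · simp only [hΦd]
    exact lim _ _ _ hgc ((hP.continuous_deriv_one.tendsto x).comp (arg x))

/-! ### Lower bounds for `TGV` -/

theorem inner_le_TGV_of_smooth {T α β : ℝ} (hα : 0 < α) (hβ : 0 < β) (u : L2 T) {Φ : ℝ → ℝ}
    (hΦ : ContDiff ℝ ∞ Φ) (hc : HasCompactSupport Φ) (ht : tsupport Φ ⊆ Ioo 0 T)
    (hΦβ : ∀ x, |Φ x| ≤ β) (hΦα : ∀ x, |deriv Φ x| ≤ α) :
    ENNReal.ofReal (∫ x in Ioo 0 T, u x * deriv (deriv Φ) x) ≤ TGV T α β u := by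
  have hd : ContDiff ℝ ∞ (deriv Φ) := ((contDiff_infty_iff_deriv (f := Φ)).1 hΦ).2
  refine le_iInf₂ fun w hw => ?_
  have h1 : IsUnitTest T (fun x => (-α⁻¹) * deriv Φ x) := by
    refine ⟨contDiff_const.mul hd, hc.deriv.mul_left, ?_, fun x => ?_⟩
    · exact (tsupport_mul_subset_right (f := fun _ => -α⁻¹)).trans
        (tsupport_deriv_subset.trans ht)
    · rw [abs_mul, abs_neg, abs_inv, abs_of_pos hα, inv_mul_le_iff₀ hα, mul_one]
      exact hΦα x
  have h2 : IsUnitTest T (fun x => β⁻¹ * Φ x) := by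
    refine ⟨contDiff_const.mul hΦ, hc.mul_left, ?_, fun x => ?_⟩
    · exact (tsupport_mul_subset_right (f := fun _ => β⁻¹)).trans ht
    · rw [abs_mul, abs_inv, abs_of_pos hβ, inv_mul_le_iff₀ hβ, mul_one]
      exact hΦβ x
  have e1 := le_iSup₂ (f := fun (v : ℝ → ℝ) (_ : IsUnitTest T v) =>
    ENNReal.ofReal (-(∫ x in Ioo 0 T, u x * deriv v x) - ∫ x in Ioo 0 T, w x * v x)) _ h1
  have e2 := le_iSup₂ (f := fun (v : ℝ → ℝ) (_ : IsUnitTest T v) =>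
    ENNReal.ofReal (-(∫ x in Ioo 0 T, w x * deriv v x) - ∫ x in Ioo 0 T, 0 * v x)) _ h2
  have d1 : ∀ x, deriv (fun x => (-α⁻¹) * deriv Φ x) x = (-α⁻¹) * deriv (deriv Φ) x := fun x =>
    deriv_const_mul _ (hd.differentiable (by simp) x)
  have d2 : ∀ x, deriv (fun x => β⁻¹ * Φ x) x = β⁻¹ * deriv Φ x := fun x =>
    deriv_const_mul _ (hΦ.differentiable (by simp) x)
  simp only [d1, mul_left_comm _ (-α⁻¹), integral_const_mul] at e1
  simp only [d2, mul_left_comm _ (β⁻¹), integral_const_mul, zero_mul, integral_zero, mul_zero,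
    sub_zero] at e2
  have key : ∫ x in Ioo 0 T, u x * deriv (deriv Φ) x =
      α * (-((-α⁻¹) * ∫ x in Ioo 0 T, u x * deriv (deriv Φ) x) -
        (-α⁻¹) * ∫ x in Ioo 0 T, w x * deriv Φ x) +
      β * (-(β⁻¹ * ∫ x in Ioo 0 T, w x * deriv Φ x)) := by
    field_simp
    ring
  rw [key]
  refine ENNReal.ofReal_add_le.trans ?_
  rw [ENNReal.ofReal_mul hα.le, ENNReal.ofReal_mul hβ.le]
  gcongr
  · exact e1
  · simpa [TV, radonNormSub] using e2

theorem prim_eq_zero_of_notMem {T : ℝ} {h : ℝ → ℝ} (hi : Integrable h)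
    (h0 : ∀ x, x ∉ Ioo 0 T → h x = 0) (h1 : prim h T = 0) {x : ℝ} (hx : x ∉ Ioo 0 T) :
    prim h x = 0 := by
  rcases le_or_gt x 0 with hx0 | hx0
  · refine intervalIntegral.integral_zero_ae (ae_of_all _ fun y hy => h0 y ?_)
    rw [uIoc_of_ge hx0] at hy
    exact fun hy' => hy'.1.not_ge hy.2
  · have hxT : T ≤ x := not_lt.1 fun h => hx ⟨hx0, h⟩
    have h2 : ∫ s in T..x, h s = 0 := by
      refine intervalIntegral.integral_zero_ae (ae_of_all _ fun y hy => h0 y ?_)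
      rw [uIoc_of_le hxT] at hy
      exact fun hy' => hy'.2.not_gt hy.1
    have h3 := intervalIntegral.integral_add_adjacent_intervals
      (hi.intervalIntegrable (a := 0) (b := T)) (hi.intervalIntegrable (a := T) (b := x))
    unfold prim at h1 ⊢
    rw [← h3, h1, h2, add_zero]

/-- The primitives of an `L²` function that is orthogonal to the affine functions extend by zero. -/
theorem exists_contDiff_extension {T : ℝ} (hT : 0 ≤ T) (q : L2 T) (h1 : prim q T = 0)
    (h2 : prim (prim q) T = 0) :
    ∃ P : ℝ → ℝ, ContDiff ℝ 1 P ∧ (∀ x, x ∉ Ioo 0 T → P x = 0 ∧ deriv P x = 0) ∧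
      ∀ x ∈ Icc 0 T, P x = prim (prim q) x ∧ deriv P x = prim q x := by
  set q' : ℝ → ℝ := (Ioo 0 T).indicator q with hq'
  have hq'i : Integrable q' :=
    (integrable_indicator_iff measurableSet_Ioo).2 ((Lp.memLp q).integrable (by norm_num))
  have e1 : ∀ x ∈ Icc 0 T, prim q' x = prim q x := fun x hx => by
    unfold prim
    rw [intervalIntegral.integral_of_le hx.1, intervalIntegral.integral_of_le hx.1,
      integral_Ioc_eq_integral_Ioo, integral_Ioc_eq_integral_Ioo]
    refine setIntegral_congr_fun measurableSet_Ioo fun y hy => ?_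
    exact indicator_of_mem (Ioo_subset_Ioo le_rfl hx.2 hy) _
  have e2 : ∀ x ∈ Icc 0 T, prim (prim q') x = prim (prim q) x := fun x hx => by
    refine intervalIntegral.integral_congr fun y hy => ?_
    rw [uIcc_of_le hx.1] at hy
    exact e1 y ⟨hy.1, hy.2.trans hx.2⟩
  have hTm : T ∈ Icc 0 T := ⟨hT, le_rfl⟩
  have z1 : ∀ x, x ∉ Ioo 0 T → prim q' x = 0 := fun x hx =>
    prim_eq_zero_of_notMem hq'i (fun y hy => indicator_of_notMem hy _)
      ((e1 T hTm).trans h1) hx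
  have c1 : Continuous (prim q') :=
    intervalIntegral.continuous_primitive (fun a b => hq'i.intervalIntegrable) 0
  have i1 : Integrable (prim q') := c1.integrable_of_hasCompactSupport
    (HasCompactSupport.intro (isCompact_Icc (a := 0) (b := T)) fun x hx =>
      z1 x fun h => hx (Ioo_subset_Icc_self h))
  have d : ∀ x, HasDerivAt (prim (prim q')) (prim q' x) x := fun x =>
    c1.integral_hasStrictDerivAt 0 x |>.hasDerivAt
  have d' : deriv (prim (prim q')) = prim q' := funext fun x => (d x).deriv
  refine ⟨prim (prim q'), ?_, fun x hx => ⟨?_, ?_⟩, fun x hx => ⟨e2 x hx, ?_⟩⟩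
  · rw [contDiff_one_iff_deriv, d']
    exact ⟨fun x => (d x).differentiableAt, c1⟩
  · exact prim_eq_zero_of_notMem i1 z1 ((e2 T hTm).trans h2) hx
  · rw [d']; exact z1 x hx
  · rw [d']; exact e1 x hx

/-- The atoms `±S_y/α` and `±K_y/β` with `y ∈ (0,T)`. -/
def IsAtom (T α β : ℝ) (a : L2 T) : Prop :=
  ∃ σ : ℝ, (σ = 1 ∨ σ = -1) ∧ ∃ y ∈ Ioo 0 T,
    a = (σ / α) • jump T y ∨ a = (σ / β) • kink T y

theorem isAtom_of_mem_extB {T α β : ℝ} (hα : 0 < α) (hβ : 0 < β) {a : L2 T}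
    (ha : a ∈ extB T α β) : IsAtom T α β a := by
  obtain ⟨σ, hσ, ⟨y, hy, rfl⟩ | ⟨y, hy, rfl⟩⟩ := ha
  · exact ⟨σ, hσ, y, hy, Or.inl rfl⟩
  · have : 0 < β / α := by positivity
    exact ⟨σ, hσ, y, ⟨this.trans hy.1, by linarith [hy.2]⟩, Or.inr rfl⟩

theorem IsAtom.tgvLe {T α β : ℝ} (hα : 0 < α) (hβ : 0 < β) {a : L2 T} (ha : IsAtom T α β a) :
    TGVLe T α β a 1 := by
  obtain ⟨σ, hσ, y, hy, h⟩ := ha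
  have hj := (tgvLe_jump α β (Ioo_subset_Icc_self hy)).smul (inv_nonneg.2 hα.le)
  have hk := (tgvLe_kink α β (Ioo_subset_Icc_self hy)).smul (inv_nonneg.2 hβ.le)
  rw [inv_mul_cancel₀ hα.ne'] at hj
  rw [inv_mul_cancel₀ hβ.ne'] at hk
  rcases hσ with rfl | rfl <;> rcases h with rfl | rfl
  · simpa [one_div] using hj
  · simpa [one_div] using hk
  · simpa [neg_div, one_div] using hj.neg
  · simpa [neg_div, one_div] using hk.neg

theorem tgvLe_combo {T α β : ℝ} (hT : 0 ≤ T) (hα : 0 < α) (hβ : 0 < β) {A : Finset (L2 T)}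
    {lam : L2 T → ℝ} {ℓ : L2 T} (hA : ∀ a ∈ A, IsAtom T α β a) (hlam : ∀ a ∈ A, 0 ≤ lam a)
    (hℓ : ℓ ∈ affineL2 T) : TGVLe T α β (combo A lam ℓ) (∑ a ∈ A, lam a) := by
  have := TGVLe.sum A (fun a => lam a • a) lam (fun a ha => by
    simpa using ((hA a ha).tgvLe hα hβ).smul (hlam a ha)) (tgvLe_affine α β hT hℓ)
  simpa [combo] using this

/-- Duality: `⟨u, q⟩ ≤ TGV(u)` for `u` in the span of the atoms and the affine functions, if `q` is
orthogonal to the affine functions and its primitives are bounded by `α` and `β`. -/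
theorem inner_combo_le_TGV {T α β : ℝ} (hT : 0 < T) (hα : 0 < α) (hβ : 0 < β)
    {A : Finset (L2 T)} {lam : L2 T → ℝ} {ℓ : L2 T} (hA : ∀ a ∈ A, IsAtom T α β a)
    (hℓ : ℓ ∈ affineL2 T) (q : L2 T) (h1 : prim q T = 0) (h2 : prim (prim q) T = 0)
    (b1 : ∀ x ∈ Ioo 0 T, |prim q x| ≤ α) (b2 : ∀ x ∈ Ioo 0 T, |prim (prim q) x| ≤ β) :
    ENNReal.ofReal (inner ℝ (combo A lam ℓ) q) ≤ TGV T α β (combo A lam ℓ) := by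
  obtain ⟨P, hPC, hP0, hPq⟩ := exists_contDiff_extension hT.le q h1 h2
  have hPβ : ∀ x, |P x| ≤ β := fun x => by
    by_cases hx : x ∈ Ioo 0 T
    · rw [(hPq x (Ioo_subset_Icc_self hx)).1]; exact b2 x hx
    · rw [(hP0 x hx).1, abs_zero]; exact hβ.le
  have hPα : ∀ x, |deriv P x| ≤ α := fun x => by
    by_cases hx : x ∈ Ioo 0 T
    · rw [(hPq x (Ioo_subset_Icc_self hx)).2]; exact b1 x hx
    · rw [(hP0 x hx).2, abs_zero]; exact hα.le
  obtain ⟨Φ, hΦ, hlim⟩ := exists_smooth_approx hT hPC (fun x hx => (hP0 x hx).1) hPβ hPα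
  have hd : ∀ n, ContDiff ℝ ∞ (deriv (Φ n)) := fun n =>
    ((contDiff_infty_iff_deriv (f := Φ n)).1 (hΦ n).1).2
  have hc : ∀ n, Continuous (deriv (deriv (Φ n))) := fun n =>
    ((contDiff_infty_iff_deriv (f := deriv (Φ n))).1 (hd n)).2.continuous
  let ψ : ℕ → L2 T := fun n => ofCont T (hc n)
  have z : ∀ n x, x ∉ Ioo 0 T → Φ n x = 0 ∧ deriv (Φ n) x = 0 := fun n x hx =>
    ⟨image_eq_zero_of_notMem_tsupport fun h => hx ((hΦ n).2.2.1 h),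
      image_eq_zero_of_notMem_tsupport fun h =>
        hx ((hΦ n).2.2.1 (tsupport_deriv_subset h))⟩
  have p1 : ∀ n, prim (deriv (deriv (Φ n))) = deriv (Φ n) := fun n =>
    prim_deriv ((hd n).of_le (by simp)) (z n 0 (by simp)).2
  have p2 : ∀ n, prim (deriv (Φ n)) = Φ n := fun n =>
    prim_deriv ((hΦ n).1.of_le (by simp)) (z n 0 (by simp)).1
  have q1 : ∀ n, ∀ x ∈ Icc 0 T, prim (ψ n) x = deriv (Φ n) x := fun n x hx => by
    rw [prim_ofCont hx, p1]
  have q2 : ∀ n, ∀ x ∈ Icc 0 T, prim (prim (ψ n)) x = Φ n x := fun n x hx => by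
    rw [prim_prim_ofCont hx, p1, p2]
  have hTm : T ∈ Icc 0 T := ⟨hT.le, le_rfl⟩
  have r1 : ∀ n, prim (ψ n) T = 0 := fun n => (q1 n T hTm).trans (z n T (by simp)).2
  have r2 : ∀ n, prim (prim (ψ n)) T = 0 := fun n => (q2 n T hTm).trans (z n T (by simp)).1
  have lj : ∀ y ∈ Icc 0 T,
      Tendsto (fun n => inner ℝ (jump T y) (ψ n)) atTop (𝓝 (inner ℝ (jump T y) q)) :=
    fun y hy => by
      simp only [inner_jump hy, r1, h1, q1 _ y hy]
      rw [← (hPq y hy).2]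
      exact (hlim y).2.const_sub 0
  have lk : ∀ y ∈ Icc 0 T,
      Tendsto (fun n => inner ℝ (kink T y) (ψ n)) atTop (𝓝 (inner ℝ (kink T y) q)) :=
    fun y hy => by
      simp only [inner_kink hy _ (r1 _) (r2 _), inner_kink hy _ h1 h2, q2 _ y hy]
      rw [← (hPq y hy).1]
      exact (hlim y).1
  have la : ∀ a ∈ A, Tendsto (fun n => inner ℝ (lam a • a) (ψ n)) atTop
      (𝓝 (inner ℝ (lam a • a) q)) := fun a ha => by
    obtain ⟨σ, -, y, hy, rfl | rfl⟩ := hA a ha <;> simp only [real_inner_smul_left]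
    · exact ((lj y (Ioo_subset_Icc_self hy)).const_mul _).const_mul _
    · exact ((lk y (Ioo_subset_Icc_self hy)).const_mul _).const_mul _
  have lc : Tendsto (fun n => inner ℝ (combo A lam ℓ) (ψ n)) atTop
      (𝓝 (inner ℝ (combo A lam ℓ) q)) := by
    obtain ⟨c, d, rfl⟩ := mem_affineL2_iff.1 hℓ
    simp only [combo, inner_add_left, sum_inner, inner_affineElem hT.le, r1, r2, h1, h2]
    exact (tendsto_finsetSum A la).add tendsto_const_nhds
  refine le_of_tendsto ((ENNReal.continuous_ofReal.tendsto _).comp lc)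
    (Eventually.of_forall fun n => ?_)
  have := inner_le_TGV_of_smooth hα hβ (combo A lam ℓ) (hΦ n).1 (hΦ n).2.1 (hΦ n).2.2.1
    (hΦ n).2.2.2.1 (hΦ n).2.2.2.2
  rw [Function.comp_apply, real_inner_comm, inner_ofCont]
  exact this

/-! ### Optimality conditions of the subproblems -/

theorem inner_gradient_eq_of_eventually_le {T : ℝ} {f : L2 T → ℝ} {u v : L2 T} {c : ℝ}
    (hf : DifferentiableAt ℝ f u) (h : ∀ᶠ t in 𝓝 (0 : ℝ), f u ≤ f (u + t • v) + c * t) :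
    inner ℝ v (gradient f u) = -c := by
  have h1 : HasDerivAt (fun t : ℝ => u + t • v) v 0 := by
    simpa using ((hasDerivAt_id (0 : ℝ)).smul_const v).const_add u
  have h0 : HasFDerivAt f (InnerProductSpace.toDual ℝ (L2 T) (gradient f u))
      (u + (0 : ℝ) • v) := by
    simpa using hf.hasGradientAt.hasFDerivAt
  have h2 := h0.comp_hasDerivAt (0 : ℝ) h1
  have h3 := h2.add ((hasDerivAt_id (0 : ℝ)).const_mul c)
  have hmin : IsLocalMin (f ∘ (fun t : ℝ => u + t • v) + fun t : ℝ => c * id t) 0 := by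
    filter_upwards [h] with t ht
    simpa using ht
  have := hmin.hasDerivAt_eq_zero h3
  rw [InnerProductSpace.toDual_apply_apply, real_inner_comm] at this
  linarith

open Classical in
theorem combo_add_single {T : ℝ} {A : Finset (L2 T)} {a : L2 T} (ha : a ∈ A) (lam : L2 T → ℝ)
    (ℓ : L2 T) (t : ℝ) :
    combo A (fun b => lam b + if b = a then t else 0) ℓ = combo A lam ℓ + t • a := by
  simp only [combo, add_smul, Finset.sum_add_distrib, ite_smul, zero_smul, Finset.sum_ite_eq',
    if_pos ha]
  abel

open Classical in
theorem sum_add_single {T : ℝ} {A : Finset (L2 T)} {a : L2 T} (ha : a ∈ A) (lam : L2 T → ℝ)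
    (t : ℝ) : ∑ b ∈ A, (lam b + if b = a then t else 0) = ∑ b ∈ A, lam b + t := by
  simp only [Finset.sum_add_distrib, Finset.sum_ite_eq', if_pos ha]

theorem zero_mem_affineL2 (T : ℝ) : (0 : L2 T) ∈ affineL2 T :=
  mem_affineL2_iff.2 ⟨0, 0, by simpa using affineElem_smul T 0 0 0⟩

theorem add_mem_affineL2 {T : ℝ} {ℓ ℓ' : L2 T} (h : ℓ ∈ affineL2 T) (h' : ℓ' ∈ affineL2 T) :
    ℓ + ℓ' ∈ affineL2 T := by
  obtain ⟨c, d, rfl⟩ := mem_affineL2_iff.1 h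
  obtain ⟨c', d', rfl⟩ := mem_affineL2_iff.1 h'
  rw [affineElem_add]
  exact affineElem_mem _ _ _

theorem smul_mem_affineL2 {T : ℝ} {ℓ : L2 T} (r : ℝ) (h : ℓ ∈ affineL2 T) :
    r • ℓ ∈ affineL2 T := by
  obtain ⟨c, d, rfl⟩ := mem_affineL2_iff.1 h
  rw [affineElem_smul]
  exact affineElem_mem _ _ _

namespace IsSubproblemMin

variable {T : ℝ} {f : L2 T → ℝ} {A : Finset (L2 T)} {lam : L2 T → ℝ} {ℓ : L2 T}

theorem inner_affine (h : IsSubproblemMin f A lam ℓ)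
    (hf : DifferentiableAt ℝ f (combo A lam ℓ)) {ℓ' : L2 T} (hℓ' : ℓ' ∈ affineL2 T) :
    inner ℝ ℓ' (gradient f (combo A lam ℓ)) = 0 := by
  suffices h : inner ℝ ℓ' (gradient f (combo A lam ℓ)) = -0 by rwa [neg_zero] at h
  refine inner_gradient_eq_of_eventually_le hf (Eventually.of_forall fun t => ?_)
  have := h.2.2 lam (ℓ + t • ℓ') h.1 (add_mem_affineL2 h.2.1 (smul_mem_affineL2 t hℓ'))
  have e : combo A lam (ℓ + t • ℓ') = combo A lam ℓ + t • ℓ' := by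
    simp only [combo, add_assoc]
  rw [e] at this
  linarith

theorem inner_active (h : IsSubproblemMin f A lam ℓ)
    (hf : DifferentiableAt ℝ f (combo A lam ℓ)) {a : L2 T} (ha : a ∈ A) (hne : lam a ≠ 0) :
    inner ℝ a (gradient f (combo A lam ℓ)) = -1 := by
  classical
  have hpos : 0 < lam a := (h.1 a ha).lt_of_ne' hne
  refine inner_gradient_eq_of_eventually_le hf ?_
  filter_upwards [lt_mem_nhds (neg_neg_of_pos hpos)] with t ht
  have := h.2.2 (fun b => lam b + if b = a then t else 0) ℓ (fun b hb => ?_) h.2.1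
  · rw [combo_add_single ha, sum_add_single ha] at this
    linarith
  · split_ifs with hba
    · rw [hba]; linarith
    · simpa using h.1 b hb

theorem sum_le (h : IsSubproblemMin f A lam ℓ) {Cf : ℝ} (hb : ∀ u, -Cf ≤ f u) :
    ∑ a ∈ A, lam a ≤ f 0 + Cf := by
  have := h.2.2 (fun _ => 0) 0 (fun _ _ => le_rfl) (zero_mem_affineL2 T)
  have e : combo A (fun _ => 0) 0 = (0 : L2 T) := by simp [combo]
  rw [e, Finset.sum_const_zero, add_zero] at this
  linarith [hb (combo A lam ℓ)]

open Classical in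
theorem le_of_insert {A' : Finset (L2 T)} {lam' : L2 T → ℝ} {ℓ' v : L2 T}
    (h : IsSubproblemMin f (insert v A') lam ℓ) (h' : ∀ a ∈ A', 0 ≤ lam' a)
    (hℓ' : ℓ' ∈ affineL2 T) {s : ℝ} (hs : 0 ≤ s) :
    f (combo (insert v A') lam ℓ) + ∑ a ∈ insert v A', lam a ≤
      f (combo A' lam' ℓ' + s • v) + (∑ a ∈ A', lam' a + s) := by
  set μ : L2 T → ℝ := fun b => if b ∈ A' then lam' b else 0
  have hμ : ∀ a ∈ A', μ a = lam' a := fun a ha => if_pos ha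
  have hμ0 : ∀ a, a ∉ A' → μ a = 0 := fun a ha => if_neg ha
  have e1 : combo (insert v A') μ ℓ' = combo A' lam' ℓ' := by
    unfold combo
    congr 1
    rw [← Finset.sum_subset (Finset.subset_insert v A') fun a _ ha => by
      rw [hμ0 a ha, zero_smul]]
    exact Finset.sum_congr rfl fun a ha => by rw [hμ a ha]
  have e2 : ∑ a ∈ insert v A', μ a = ∑ a ∈ A', lam' a := by
    rw [← Finset.sum_subset (Finset.subset_insert v A') fun a _ ha => hμ0 a ha]
    exact Finset.sum_congr rfl hμ
  have := h.2.2 (fun b => μ b + if b = v then s else 0) ℓ' (fun b _ => ?_) hℓ'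
  · rwa [combo_add_single (Finset.mem_insert_self v A'),
      sum_add_single (Finset.mem_insert_self v A'), e1, e2] at this
  · refine add_nonneg ?_ ?_
    · by_cases hb : b ∈ A'
      · rw [hμ b hb]; exact h' b hb
      · rw [hμ0 b hb]
    · split_ifs
      exacts [hs, le_rfl]

end IsSubproblemMin

theorem le_add_inner_add_sq {T Lf : ℝ} {f : L2 T → ℝ} (hLf : 0 ≤ Lf)
    (hf : Differentiable ℝ f)
    (hLip : ∀ u₁ u₂ : L2 T, ‖gradient f u₁ - gradient f u₂‖ ≤ Lf * ‖u₁ - u₂‖) (u h : L2 T) :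
    f (u + h) ≤ f u + inner ℝ h (gradient f u) + Lf * ‖h‖ ^ 2 := by
  have key := (convex_closedBall u ‖h‖).norm_image_sub_le_of_norm_hasFDerivWithin_le'
    (f := f) (f' := fun x => InnerProductSpace.toDual ℝ (L2 T) (gradient f x))
    (φ := InnerProductSpace.toDual ℝ (L2 T) (gradient f u)) (C := Lf * ‖h‖)
    (x := u) (y := u + h)
    (fun x _ => (hf x).hasGradientAt.hasFDerivAt.hasFDerivWithinAt)
    (fun x hx => by
      rw [← map_sub, LinearIsometryEquiv.norm_map]
      refine (hLip x u).trans ?_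
      gcongr
      simpa [dist_eq_norm] using hx)
    (Metric.mem_closedBall_self (norm_nonneg h)) (by simp)
  rw [add_sub_cancel_left, InnerProductSpace.toDual_apply_apply, real_inner_comm,
    Real.norm_eq_abs] at key
  nlinarith [(abs_le.1 key).2]

/-! ### Dual variables -/

theorem prim_smul {T x : ℝ} (hx : x ∈ Icc 0 T) (c : ℝ) (g : L2 T) :
    prim ((c • g : L2 T) : ℝ → ℝ) x = c * prim g x := by
  unfold prim
  rw [← intervalIntegral.integral_const_mul, intervalIntegral.integral_of_le hx.1,
    intervalIntegral.integral_of_le hx.1, integral_Ioc_eq_integral_Ioo,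
    integral_Ioc_eq_integral_Ioo]
  apply integral_congr_ae
  exact ae_restrict_of_ae_restrict_of_subset (Ioo_subset_Ioo le_rfl hx.2) (Lp.coeFn_smul c g)

theorem prim_prim_smul {T x : ℝ} (hx : x ∈ Icc 0 T) (c : ℝ) (g : L2 T) :
    prim (prim ((c • g : L2 T) : ℝ → ℝ)) x = c * prim (prim g) x := by
  rw [prim, prim, ← intervalIntegral.integral_const_mul]
  refine intervalIntegral.integral_congr fun y hy => ?_
  rw [uIcc_of_le hx.1] at hy
  exact prim_smul ⟨hy.1, hy.2.trans hx.2⟩ c g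

theorem abs_le_supNorm {T : ℝ} {h k : ℝ → ℝ} (hk : Continuous k)
    (hhk : ∀ x ∈ Icc 0 T, |h x| = |k x|) {x : ℝ} (hx : x ∈ Ioo 0 T) : |h x| ≤ supNorm T h := by
  obtain ⟨C, hC⟩ := (isCompact_Icc (a := (0 : ℝ)) (b := T)).exists_bound_of_continuousOn
    hk.continuousOn
  refine le_ciSup (f := fun x : Ioo (0 : ℝ) T => |h x|) ⟨C, ?_⟩ ⟨x, hx⟩
  rintro _ ⟨y, rfl⟩
  have hy := Ioo_subset_Icc_self y.2
  exact (hhk y hy).le.trans (hC y hy)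

/-- The violation `max {‖p‖/α, ‖P‖/β}` of the dual constraints. -/
def dualMax (T α β : ℝ) (f : L2 T → ℝ) (u : L2 T) : ℝ :=
  max (supNorm T (dualp f u) / α) (supNorm T (dualP f u) / β)

section dual

variable {T α β : ℝ} {f : L2 T → ℝ} {u : L2 T}

theorem abs_dual_le (hT : 0 ≤ T) (h1 : prim (gradient f u : L2 T) T = 0)
    (h2 : prim (prim (gradient f u : L2 T)) T = 0) {x : ℝ} (hx : x ∈ Ioo 0 T) :
    |prim (gradient f u : L2 T) x| ≤ supNorm T (dualp f u) ∧
      |prim (prim (gradient f u : L2 T)) x| ≤ supNorm T (dualP f u) := by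
  obtain ⟨P, hP, -, hPq⟩ := exists_contDiff_extension hT (gradient f u) h1 h2
  have eP : ∀ x, dualP f u x = -prim (prim (gradient f u : L2 T)) x := fun x => rfl
  constructor
  · exact abs_le_supNorm (h := dualp f u) hP.continuous_deriv_one
      (fun y hy => by rw [(hPq y hy).2]; rfl) hx
  · rw [← abs_neg, ← eP]
    exact abs_le_supNorm hP.continuous (fun y hy => by rw [eP, abs_neg, (hPq y hy).1]) hx

theorem sign_mul_self_eq_abs (r : ℝ) : Real.sign r * r = |r| := by
  rcases lt_trichotomy r 0 with h | rfl | h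
  · rw [Real.sign_of_neg h, abs_of_neg h]; ring
  · simp
  · rw [Real.sign_of_pos h, abs_of_pos h]; ring

theorem sign_eq_or_of_ne_zero {r : ℝ} (h : r ≠ 0) : Real.sign r = 1 ∨ Real.sign r = -1 := by
  rcases h.lt_or_gt with h | h
  · exact Or.inr (Real.sign_of_neg h)
  · exact Or.inl (Real.sign_of_pos h)

theorem IsCandidate.isAtom_and_inner {v : L2 T} (h : IsCandidate T α β f u v) (h1 : prim (gradient f u : L2 T) T = 0)
    (h2 : prim (prim (gradient f u : L2 T)) T = 0) (hm : 1 < dualMax T α β f u) :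
    IsAtom T α β v ∧ inner ℝ v (gradient f u) = -dualMax T α β f u := by
  obtain ⟨xS, hS, xK, hK, eS, eK, rfl⟩ := h
  split_ifs with hc
  · have em : dualMax T α β f u = |dualp f u xS| / α := by rw [dualMax, max_eq_left hc, eS]
    have hne : dualp f u xS ≠ 0 := fun h => by
      rw [em, h, abs_zero, zero_div] at hm
      linarith
    refine ⟨⟨_, sign_eq_or_of_ne_zero hne, xS, hS, Or.inl rfl⟩, ?_⟩
    rw [real_inner_smul_left, inner_jump (Ioo_subset_Icc_self hS), h1, em,
      ← sign_mul_self_eq_abs]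
    have : prim (gradient f u : L2 T) xS = dualp f u xS := rfl
    rw [this]
    ring
  · have em : dualMax T α β f u = |dualP f u xK| / β := by
      rw [dualMax, max_eq_right (not_le.1 hc).le, eK]
    have hne : dualP f u xK ≠ 0 := fun h => by
      rw [em, h, abs_zero, zero_div] at hm
      linarith
    refine ⟨⟨_, sign_eq_or_of_ne_zero hne, xK, hK, Or.inr rfl⟩, ?_⟩
    rw [real_inner_smul_left, inner_kink (Ioo_subset_Icc_self hK) _ h1 h2, em,
      ← sign_mul_self_eq_abs]
    have : dualP f u xK = -prim (prim (gradient f u : L2 T)) xK := rfl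
    rw [this]
    ring

theorem one_lt_dualMax (hα : 0 < α) (hβ : 0 < β)
    (h : ¬(supNorm T (dualp f u) ≤ α ∧ supNorm T (dualP f u) ≤ β)) :
    1 < dualMax T α β f u := by
  by_contra hm
  obtain ⟨h1, h2⟩ := max_le_iff.1 (not_lt.1 hm)
  exact h ⟨(div_le_one hα).1 h1, (div_le_one hβ).1 h2⟩

theorem sum_div_dualMax_le_TGV (hT : 0 < T) (hα : 0 < α) (hβ : 0 < β)
    {A : Finset (L2 T)} {lam : L2 T → ℝ} {ℓ : L2 T} (hu : u = combo A lam ℓ)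
    (hA : ∀ a ∈ A, IsAtom T α β a) (hℓ : ℓ ∈ affineL2 T)
    (haff : ∀ ℓ' ∈ affineL2 T, inner ℝ ℓ' (gradient f u) = 0)
    (hact : ∀ a ∈ A, inner ℝ a (gradient f u) = -1) (hm : 1 < dualMax T α β f u) :
    ENNReal.ofReal ((∑ a ∈ A, lam a) / dualMax T α β f u) ≤ TGV T α β u := by
  set m := dualMax T α β f u
  have hm0 : 0 < m := one_pos.trans hm
  obtain ⟨h1, h2⟩ := prim_eq_zero_of_orthogonal hT.le haff
  have hTm : T ∈ Icc 0 T := ⟨hT.le, le_rfl⟩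
  have e : inner ℝ u ((-m⁻¹) • gradient f u) = (∑ a ∈ A, lam a) / m := by
    have : inner ℝ u (gradient f u) = -∑ a ∈ A, lam a := by
      have hc : inner ℝ u (gradient f u) = inner ℝ (combo A lam ℓ) (gradient f u) :=
        congrArg (fun z => inner ℝ z (gradient f u)) hu
      rw [hc, combo, inner_add_left, haff ℓ hℓ, sum_inner, add_zero, ← Finset.sum_neg_distrib]
      refine Finset.sum_congr rfl fun a ha => ?_
      rw [real_inner_smul_left, hact a ha]
      ring
    rw [real_inner_smul_right, this]
    field_simp
  have := inner_combo_le_TGV hT hα hβ hA hℓ (lam := lam) ((-m⁻¹) • gradient f u)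
    (by rw [prim_smul hTm, h1, mul_zero]) (by rw [prim_prim_smul hTm, h2, mul_zero])
    (fun x hx => ?_) (fun x hx => ?_)
  · rwa [← hu, e] at this
  · rw [prim_smul (Ioo_subset_Icc_self hx), abs_mul, abs_neg, abs_inv, abs_of_pos hm0,
      inv_mul_le_iff₀ hm0]
    exact (abs_dual_le hT.le h1 h2 hx).1.trans ((div_le_iff₀ hα).1 (le_max_left _ _))
  · rw [prim_prim_smul (Ioo_subset_Icc_self hx), abs_mul, abs_neg, abs_inv, abs_of_pos hm0,
      inv_mul_le_iff₀ hm0]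
    exact (abs_dual_le hT.le h1 h2 hx).2.trans ((div_le_iff₀ hβ).1 (le_max_right _ _))

end dual

theorem exists_norm_le_of_isAtom {T α β : ℝ} (hT : 0 < T) (hα : 0 < α) (hβ : 0 < β) :
    ∃ C > 0, ∀ a, IsAtom T α β a → ‖a‖ ≤ C := by
  obtain ⟨C, hC, h⟩ := exists_norm_atom_le hT
  refine ⟨C / α + C / β, by positivity, ?_⟩
  rintro _ ⟨σ, hσ, y, hy, rfl | rfl⟩ <;> rw [norm_smul, Real.norm_eq_abs, abs_div]
  all_goals
    have hσ1 : |σ| = 1 := by rcases hσ with rfl | rfl <;> simp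
    have p1 : 0 < C / α := by positivity
    have p2 : 0 < C / β := by positivity
    rw [hσ1]
  · rw [abs_of_pos hα]
    calc 1 / α * ‖jump T y‖ ≤ 1 / α * C := by gcongr; exact (h y hy).1
      _ ≤ C / α + C / β := by rw [one_div_mul_eq_div]; linarith
  · rw [abs_of_pos hβ]
    calc 1 / β * ‖kink T y‖ ≤ 1 / β * C := by gcongr; exact (h y hy).2
      _ ≤ C / α + C / β := by rw [one_div_mul_eq_div]; linarith

/-! ### Convergence of the algorithm -/

theorem tendsto_zero_of_sq_le_sub {d e : ℕ → ℝ} {c B : ℝ} (hc : 0 < c)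
    (hd : ∀ n, 0 ≤ d n) (hB : ∀ n, B ≤ e n) (h : ∀ n, c * d n ^ 2 ≤ e n - e (n + 1)) :
    Tendsto d atTop (𝓝 0) := by
  have hanti : Antitone e := antitone_nat_of_succ_le fun n => by
    have : 0 ≤ c * d n ^ 2 := by positivity
    linarith [h n]
  have hlim := tendsto_atTop_ciInf hanti ⟨B, by rintro _ ⟨n, rfl⟩; exact hB n⟩
  have hdiff : Tendsto (fun n => (e n - e (n + 1)) / c) atTop (𝓝 0) := by
    simpa using (hlim.sub (hlim.comp (tendsto_add_atTop_nat 1))).div_const c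
  have hsq : Tendsto (fun n => d n ^ 2) atTop (𝓝 0) :=
    squeeze_zero (fun n => sq_nonneg _) (fun n => (le_div_iff₀' hc).2 (h n)) hdiff
  have := (Real.continuous_sqrt.tendsto 0).comp hsq
  rw [Real.sqrt_zero] at this
  exact this.congr fun n => Real.sqrt_sq (hd n)

namespace IsRun

variable {T α β : ℝ} {f : L2 T → ℝ} {A Aplus : ℕ → Finset (L2 T)} {lam : ℕ → L2 T → ℝ}
  {ell u uhat : ℕ → L2 T}

theorem mem_active_iff (h : IsRun T α β f A Aplus lam ell u uhat) {k : ℕ} {a : L2 T} :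
    a ∈ A (k + 1) ↔ a ∈ Aplus k ∧ lam (k + 1) a ≠ 0 := by
  rw [h.prune k, Finset.mem_filter]

theorem sum_active (h : IsRun T α β f A Aplus lam ell u uhat) (k : ℕ) :
    ∑ a ∈ A (k + 1), lam (k + 1) a = ∑ a ∈ Aplus k, lam (k + 1) a := by
  rw [h.prune k, Finset.sum_filter_ne_zero]

open Classical in
theorem eq_combo_active (h : IsRun T α β f A Aplus lam ell u uhat) (k : ℕ) :
    u (k + 1) = combo (A (k + 1)) (lam (k + 1)) (ell (k + 1)) := by
  rw [h.iterate k, h.prune k, combo, combo]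
  congr 1
  refine (Finset.sum_filter_of_ne (p := fun a => lam (k + 1) a ≠ 0) fun a _ ha hl => ha ?_).symm
  rw [hl, zero_smul]

theorem inner_affine (h : IsRun T α β f A Aplus lam ell u uhat) (hf : Differentiable ℝ f)
    (k : ℕ) {ℓ : L2 T} (hℓ : ℓ ∈ affineL2 T) : inner ℝ ℓ (gradient f (u (k + 1))) = 0 := by
  rw [h.iterate k]
  exact (h.minimize k).inner_affine (hf _) hℓ

theorem inner_active (h : IsRun T α β f A Aplus lam ell u uhat) (hf : Differentiable ℝ f)
    (k : ℕ) {a : L2 T} (ha : a ∈ A (k + 1)) : inner ℝ a (gradient f (u (k + 1))) = -1 := by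
  rw [h.iterate k]
  exact (h.minimize k).inner_active (hf _) (h.mem_active_iff.1 ha).1 (h.mem_active_iff.1 ha).2

theorem one_lt_dualMax (h : IsRun T α β f A Aplus lam ell u uhat) (hα : 0 < α) (hβ : 0 < β)
    (k : ℕ) : 1 < dualMax T α β f (u (k + 1)) :=
  TGV1D.one_lt_dualMax hα hβ (h.not_terminated (k + 1) (by omega))

theorem isAtom_candidate (h : IsRun T α β f A Aplus lam ell u uhat) (hT : 0 ≤ T)
    (hα : 0 < α) (hβ : 0 < β) (hf : Differentiable ℝ f) (k : ℕ) :
    IsAtom T α β (uhat (k + 1)) ∧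
      inner ℝ (uhat (k + 1)) (gradient f (u (k + 1))) = -dualMax T α β f (u (k + 1)) := by
  obtain ⟨h1, h2⟩ := prim_eq_zero_of_orthogonal hT fun ℓ hℓ => h.inner_affine hf k hℓ
  exact (h.candidate (k + 1) (by omega)).isAtom_and_inner h1 h2
    (h.one_lt_dualMax hα hβ k)

open Classical in
theorem isAtom_plus (h : IsRun T α β f A Aplus lam ell u uhat) (hT : 0 ≤ T)
    (hα : 0 < α) (hβ : 0 < β) (hf : Differentiable ℝ f) (k : ℕ) :
    ∀ a ∈ Aplus k, IsAtom T α β a := by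
  induction k with
  | zero =>
    rw [h.plus_zero]
    exact fun a ha => isAtom_of_mem_extB hα hβ (h.init a ha)
  | succ k ih =>
    intro a ha
    rw [h.plus (k + 1) (by omega), Finset.mem_insert] at ha
    rcases ha with rfl | ha
    · exact (h.isAtom_candidate hT hα hβ hf k).1
    · exact ih a (h.mem_active_iff.1 ha).1

theorem isAtom_active (h : IsRun T α β f A Aplus lam ell u uhat) (hT : 0 ≤ T)
    (hα : 0 < α) (hβ : 0 < β) (hf : Differentiable ℝ f) (k : ℕ) :
    ∀ a ∈ A (k + 1), IsAtom T α β a := fun a ha =>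
  h.isAtom_plus hT hα hβ hf k a (h.mem_active_iff.1 ha).1

theorem nonneg_active (h : IsRun T α β f A Aplus lam ell u uhat) (k : ℕ) :
    ∀ a ∈ A (k + 1), 0 ≤ lam (k + 1) a := fun a ha =>
  (h.minimize k).1 a (h.mem_active_iff.1 ha).1

theorem tgvLe (h : IsRun T α β f A Aplus lam ell u uhat) (hT : 0 ≤ T)
    (hα : 0 < α) (hβ : 0 < β) (hf : Differentiable ℝ f) (k : ℕ) :
    TGVLe T α β (u (k + 1)) (∑ a ∈ A (k + 1), lam (k + 1) a) := by
  rw [h.eq_combo_active k]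
  exact tgvLe_combo hT hα hβ (h.isAtom_active hT hα hβ hf k) (h.nonneg_active k)
    (h.minimize k).2.1

/-- The objective of the subproblems decreases at least quadratically in the constraint
violation. -/
theorem exists_sq_le_sub (h : IsRun T α β f A Aplus lam ell u uhat) (hT : 0 < T) (hα : 0 < α)
    (hβ : 0 < β) (hf : Differentiable ℝ f) {Lf : ℝ} (hLf : 0 < Lf)
    (hLip : ∀ u₁ u₂ : L2 T, ‖gradient f u₁ - gradient f u₂‖ ≤ Lf * ‖u₁ - u₂‖) :
    ∃ c > 0, ∀ k, c * (dualMax T α β f (u (k + 1)) - 1) ^ 2 ≤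
      (f (u (k + 1)) + ∑ a ∈ A (k + 1), lam (k + 1) a) -
        (f (u (k + 2)) + ∑ a ∈ A (k + 2), lam (k + 2) a) := by
  obtain ⟨C, hC, hbd⟩ := exists_norm_le_of_isAtom hT hα hβ (T := T)
  refine ⟨1 / (4 * Lf * C ^ 2), by positivity, fun k => ?_⟩
  obtain ⟨hv, hin⟩ := h.isAtom_candidate hT.le hα hβ hf k
  have hm := h.one_lt_dualMax hα hβ k
  set m := dualMax T α β f (u (k + 1))
  set v := uhat (k + 1)
  set s := (m - 1) / (2 * Lf * C ^ 2) with hs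
  have hs0 : 0 ≤ s := div_nonneg (by linarith) (by positivity)
  have hmin := h.minimize (k + 1)
  have hit := h.iterate (k + 1)
  have hsum := h.sum_active (k + 1)
  rw [h.plus (k + 1) (by omega)] at hmin hit hsum
  have h1 := hmin.le_of_insert (h.nonneg_active k) (h.minimize k).2.1 hs0
  rw [← hit, ← hsum, ← h.eq_combo_active k] at h1
  have h2 := le_add_inner_add_sq hLf.le hf hLip (u (k + 1)) (s • v)
  rw [real_inner_smul_left, hin, norm_smul, Real.norm_eq_abs, abs_of_nonneg hs0] at h2
  have h3 : Lf * (s * ‖v‖) ^ 2 ≤ Lf * (s * C) ^ 2 := by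
    gcongr
    exact hbd v hv
  have h4 : s * (m - 1) - Lf * (s * C) ^ 2 = 1 / (4 * Lf * C ^ 2) * (m - 1) ^ 2 := by
    rw [hs]
    field_simp
    ring
  linarith

theorem tendsto_dualMax_sub_one (h : IsRun T α β f A Aplus lam ell u uhat) (hT : 0 < T)
    (hα : 0 < α) (hβ : 0 < β) (hf : Differentiable ℝ f) {Lf : ℝ} (hLf : 0 < Lf)
    (hLip : ∀ u₁ u₂ : L2 T, ‖gradient f u₁ - gradient f u₂‖ ≤ Lf * ‖u₁ - u₂‖)
    {Cf : ℝ} (hbelow : ∀ u : L2 T, -Cf ≤ f u) :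
    Tendsto (fun k => dualMax T α β f (u (k + 1)) - 1) atTop (𝓝 0) := by
  obtain ⟨c, hc, hdec⟩ := h.exists_sq_le_sub hT hα hβ hf hLf hLip
  refine tendsto_zero_of_sq_le_sub (B := -Cf) hc
    (fun k => by linarith [h.one_lt_dualMax hα hβ k]) (fun k => ?_) hdec
  linarith [hbelow (u (k + 1)), Finset.sum_nonneg (h.nonneg_active k)]

theorem abs_sum_sub_TGV_le (h : IsRun T α β f A Aplus lam ell u uhat) (hT : 0 < T) (hα : 0 < α)
    (hβ : 0 < β) (hf : Differentiable ℝ f) {Cf : ℝ} (hbelow : ∀ u : L2 T, -Cf ≤ f u) (k : ℕ) :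
    |∑ a ∈ A (k + 1), lam (k + 1) a - (TGV T α β (u (k + 1))).toReal| ≤
      Psi T α β Cf f (u (k + 1)) := by
  have hm := h.one_lt_dualMax hα hβ k
  have hup := (h.tgvLe hT.le hα hβ hf k).TGV_le hα.le hβ.le
  have hlo := sum_div_dualMax_le_TGV hT hα hβ (h.eq_combo_active k)
    (h.isAtom_active hT.le hα hβ hf k) (h.minimize k).2.1
    (fun ℓ hℓ => h.inner_affine hf k hℓ) (fun a ha => h.inner_active hf k ha) hm
  have hsum := (h.minimize k).sum_le hbelow
  have hPsi : Psi T α β Cf f (u (k + 1)) =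
      (f 0 + Cf) * (dualMax T α β f (u (k + 1)) - 1) := rfl
  rw [← h.sum_active k] at hsum
  rw [hPsi]
  have hS := Finset.sum_nonneg (h.nonneg_active k)
  set S := ∑ a ∈ A (k + 1), lam (k + 1) a
  set m := dualMax T α β f (u (k + 1))
  have hfin := ne_top_of_le_ne_top ENNReal.ofReal_ne_top hup
  have hup' := ENNReal.toReal_le_of_le_ofReal hS hup
  have hlo' := (ENNReal.ofReal_le_iff_le_toReal hfin).1 hlo
  rw [abs_of_nonneg (by linarith)]
  have h1 : S - S / m ≤ S * (m - 1) := by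
    have h2 : S * (m - 1) - (S - S / m) = S * (m - 1) ^ 2 / m := by
      field_simp
    have h3 : 0 ≤ S * (m - 1) ^ 2 / m := by positivity
    linarith
  have h4 : S * (m - 1) ≤ (f 0 + Cf) * (m - 1) :=
    mul_le_mul_of_nonneg_right hsum (by linarith)
  linarith

end IsRun

end TGV1D

end

theorem theorem5 (T α β : ℝ) (hT : 0 < T) (hα : 0 < α) (hβ : 0 < β)
    (f : TGV1D.L2 T → ℝ) (hf : ContDiff ℝ 1 f)
    (Lf : ℝ) (hLf : 0 < Lf)
    (hLip : ∀ u₁ u₂ : TGV1D.L2 T, ‖gradient f u₁ - gradient f u₂‖ ≤ Lf * ‖u₁ - u₂‖)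
    (Cf : ℝ) (hCf : 0 < Cf) (hbelow : ∀ u : TGV1D.L2 T, -Cf ≤ f u)
    (hJ : TGV1D.SublevelsBounded T α β f)
    (A Aplus : ℕ → Finset (TGV1D.L2 T)) (lam : ℕ → TGV1D.L2 T → ℝ)
    (ell u uhat : ℕ → TGV1D.L2 T)
    (hrun : TGV1D.IsRun T α β f A Aplus lam ell u uhat) :
    (∀ k, 1 ≤ k → TGV1D.MemBV T (u k) ∧ TGV1D.TGV T α β (u k) < ⊤) ∧
    Tendsto (fun k => TGV1D.Psi T α β Cf f (u k) +
      |(∑ a ∈ A k, lam k a) - (TGV1D.TGV T α β (u k)).toReal|) atTop (𝓝 0) := by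
  have hd : Differentiable ℝ f := hf.differentiable one_ne_zero
  constructor
  · intro k hk
    obtain ⟨k, rfl⟩ := Nat.exists_eq_add_of_le' hk
    have h := hrun.tgvLe hT.le hα hβ hd k
    exact ⟨h.memBV, (h.TGV_le hα.le hβ.le).trans_lt ENNReal.ofReal_lt_top⟩
  · rw [← tendsto_add_atTop_iff_nat 1]
    have hPsi : Tendsto (fun k => TGV1D.Psi T α β Cf f (u (k + 1))) atTop (𝓝 0) := by
      simpa [TGV1D.Psi, TGV1D.dualMax] using
        (hrun.tendsto_dualMax_sub_one hT hα hβ hd hLf hLip hbelow).const_mul (f 0 + Cf)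
    have habs := squeeze_zero (fun k => abs_nonneg _)
      (fun k => hrun.abs_sum_sub_TGV_le hT hα hβ hd hbelow k) hPsi
    simpa using hPsi.add habs
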